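/- Let $V$ be a real vector space, $\rho$ a seminorm on $V$, and $d\ge 1$ an integer. Let $S(V)=\bigoplus_{k\ge 0}S(V)_k$ be the symmetric algebra of $V$ with its usual grading. For $f\in S(V)_k$ with $k\ge 1$ put $$\overline{\rho}_k(f)=\inf\Big\{\sum_{i=1}^n\rho(f_{i1})\cdots\rho(f_{ik}) : f=\sum_{i=1}^n f_{i1}\cdots f_{ik},\ f_{ij}\in V,\ n\ge 1\Big\},$$ let $\overline{\rho}_0$ be the absolute value on $S(V)_0=\mathbb{R}$, and let $\overline{\rho}(f)=\sum_k\overline{\rho}_k(f_k)$ for $f=\sum_k f_k$, $f_k\in S(V)_k$ (the projective extension of $\rho$). A linear functional $L:S(V)\to\mathbb{R}$ is $\overline{\rho}$-continuous if there is a constant $C>0$ with $|L(f)|\le C\,\overline{\rho}(f)$ for all $f\in S(V)$. Write $\sum S(V)^{2d}$ for the set of all finite sums of $2d$-th powers of elements of $S(V)$. Let $V^*=\operatorname{Hom}(V,\mathbb{R})$ be the algebraic dual, with the weakest topology for which all evaluations $v^*\mapsto v^*(w)$, $w\in V$, are continuous, and with its Borel $\sigma$-algebra. For $v^*\in V^*$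 let $\overline{v^*}:S(V)\to\mathbb{R}$ be the unique algebra homomorphism extending $v^*$, and for $f\in S(V)$ let $\hat f(v^*)=\overline{v^*}(f)$. Let $\rho'(v^*)=\inf\{C\in[0,\infty): |v^*(w)|\le C\rho(w)\ \forall w\in V\}\in[0,\infty]$ and $\overline{B}_1(\rho')=\{v^*\in V^*:\rho'(v^*)\le 1\}$. A positive Radon measure on $V^*$ is a locally finite positive Borel measure that is inner regular with respect to compact sets; it is supported by a Borel set $Y$ if $\mu(V^*\setminus Y)=0$. Then the relation $$L(f)=\int_{V^*}\hat f\,d\mu\quad\text{for all } f\in S(V)$$ (where all $\hat f$ are $\mu$-integrable) is a one-to-one correspondence $L\leftrightarrow\mu$ between the $\overline{\rho}$-continuous linear functionals $L:S(V)\to\mathbb{R}$ with $L(\sum S(V)^{2d})\subseteq[0,\infty)$ and the positive Radon measures $\mu$ on $V^*$ supported by $\overline{B}_1(\rho')$. Moreover, let $M\subseteq S(V)$ be any $2d$-power module, i.e. $1\in M$, $M+M\subseteq M$ and $a^{2d}M\subseteq M$ for all $a\in S(V)$. If $L\leftrightarrow\mu$ under this correspondence, then $L(M)\subseteq[0,\infty)$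 if and only if $\mu$ is supported by $$X_M\cap\overline{B}_1(\rho')=\{v^*\in\overline{B}_1(\rho'):\hat g(v^*)\ge 0\ \ \forall g\in M\}.$$ -/

import Mathlib

open MeasureTheory
open scoped NNReal ENNReal DirectSum

noncomputable section

namespace SymMoment

/-! ### The grading of the symmetric algebra -/

section Grading

variable (V : Type*) [AddCommGroup V] [Module ℝ V]

/-- The `k`-th homogeneous part `S(V)_k` of `S(V)`: the linear span of the products
`f_1 ⋯ f_k` with `f_j ∈ V` (the scalars, if `k = 0`). -/
abbrev homPart (k : ℕ) : Submodule ℝ (SymmetricAlgebra ℝ V) :=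
  (LinearMap.range (SymmetricAlgebra.ι ℝ V)) ^ k

/-- The inclusion of `V` in degree one of the direct sum of the homogeneous parts. -/
def gradedι : V →ₗ[ℝ] ⨁ k : ℕ, homPart V k :=
  DirectSum.lof ℝ ℕ (fun k => homPart V k) 1 ∘ₗ
    (SymmetricAlgebra.ι ℝ V).codRestrict _
      fun v => by simpa only [pow_one] using LinearMap.mem_range_self _ v

theorem gradedι_apply (v : V) :
    gradedι V v = DirectSum.of (fun k : ℕ => homPart V k) 1
      ⟨SymmetricAlgebra.ι ℝ V v,
        by simpa only [pow_one] using LinearMap.mem_range_self _ v⟩ :=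
  rfl

/-- `S(V)` is the direct sum of its homogeneous parts, as a graded algebra. -/
instance gradedAlgebra : GradedAlgebra (homPart V) :=
  GradedAlgebra.ofAlgHom _ (SymmetricAlgebra.lift (gradedι V))
    (by
      ext v
      change DirectSum.coeAlgHom (homPart V)
        (SymmetricAlgebra.lift (gradedι V) (SymmetricAlgebra.ι ℝ V v)) =
          SymmetricAlgebra.ι ℝ V v
      rw [SymmetricAlgebra.lift_ι_apply, gradedι_apply, DirectSum.coeAlgHom_of])
    fun i x => by
    obtain ⟨x, hx⟩ := x
    dsimp only [Subtype.coe_mk, DirectSum.lof_eq_of]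
    induction hx using Submodule.pow_induction_on_left' with
    | algebraMap r =>
      rw [AlgHom.commutes, DirectSum.algebraMap_apply]; rfl
    | add x y i hx hy ihx ihy =>
      rw [map_add, ihx, ihy, ← map_add]
      rfl
    | mem_mul m hm i x hx ih =>
      obtain ⟨_, rfl⟩ := hm
      rw [map_mul, ih, SymmetricAlgebra.lift_ι_apply, gradedι_apply, DirectSum.of_mul_of]
      exact DirectSum.of_eq_of_gradedMonoid_eq (Sigma.subtype_ext (add_comm _ _) rfl)

end Grading

variable {V : Type*} [AddCommGroup V] [Module ℝ V]

/-! ### The projective extension of a seminorm -/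

/-- The seminorm `ρ̄_k` on `S(V)_k`. For `k ≥ 1` it is the infimum of
`∑ i, ρ (f_{i1}) ⋯ ρ (f_{ik})` over all representations `f = ∑ i, f_{i1} ⋯ f_{ik}` with
`n ≥ 1` terms and `f_{ij} ∈ V`; for `k = 0` it is the absolute value on `S(V)_0 = ℝ`
(`algebraMapInv` reads off the scalar). -/
def projHom (ρ : Seminorm ℝ V) : (k : ℕ) → homPart V k → ℝ
  | 0, f => |SymmetricAlgebra.algebraMapInv (f : SymmetricAlgebra ℝ V)|
  | k + 1, f => sInf {r : ℝ | ∃ (n : ℕ) (g : Fin n → Fin (k + 1) → V), 1 ≤ n ∧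
      (f : SymmetricAlgebra ℝ V) = ∑ i, ∏ j, SymmetricAlgebra.ι ℝ V (g i j) ∧
      r = ∑ i, ∏ j, ρ (g i j)}

open Classical in
/-- The projective extension `ρ̄(f) = ∑ k, ρ̄_k(f_k)` of `ρ` to `S(V)`, where `f_k` is the
homogeneous component of degree `k` of `f`. -/
def projExt (ρ : Seminorm ℝ V) (f : SymmetricAlgebra ℝ V) : ℝ :=
  ∑ k ∈ (DirectSum.decompose (homPart V) f).support,
    projHom ρ k (DirectSum.decompose (homPart V) f k)

/-- A linear functional on `S(V)` is `ρ̄`-continuous: `|L f| ≤ C ρ̄(f)` for some constant `C`. -/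
def IsProjContinuous (ρ : Seminorm ℝ V) (L : SymmetricAlgebra ℝ V →ₗ[ℝ] ℝ) : Prop :=
  ∃ C : ℝ, 0 < C ∧ ∀ f, |L f| ≤ C * projExt ρ f

/-! ### Sums of powers, power modules -/

/-- `∑ A^{n}`: the set of all finite sums of `n`-th powers of elements of `A`. -/
def sumPow (A : Type*) [CommRing A] (n : ℕ) : Set A :=
  {a | ∃ (m : ℕ) (b : Fin m → A), a = ∑ i, b i ^ n}

/-- `M` is a `2d`-power module of `A`. -/
structure IsPowerModule {A : Type*} [CommRing A] (d : ℕ) (M : Set A) : Prop where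
  one_mem : (1 : A) ∈ M
  add_mem : ∀ a ∈ M, ∀ b ∈ M, a + b ∈ M
  pow_mul_mem : ∀ (a : A), ∀ b ∈ M, a ^ (2 * d) * b ∈ M

/-- `L` is nonnegative on the set `M`. -/
def IsPositiveOn {A : Type*} [CommRing A] [Algebra ℝ A] (M : Set A) (L : A →ₗ[ℝ] ℝ) : Prop :=
  ∀ a ∈ M, 0 ≤ L a

/-! ### The algebraic dual, its weak topology, and the dual norm -/

variable (V) in
/-- The algebraic dual `V* = Hom(V, ℝ)` with the weakest topology making all evaluations
`v* ↦ v*(f)`, `f ∈ V`, continuous. -/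
abbrev AlgDual : Type _ := WeakBilin (LinearMap.id : (V →ₗ[ℝ] ℝ) →ₗ[ℝ] V →ₗ[ℝ] ℝ)

/-- `V*` carries its Borel σ-algebra. -/
instance : MeasurableSpace (AlgDual V) := borel _

instance : BorelSpace (AlgDual V) := ⟨rfl⟩

/-- An element of `V*` as a linear map. -/
def AlgDual.toLin (v : AlgDual V) : V →ₗ[ℝ] ℝ := v

/-- `f̂(v*)`: the value at `f ∈ S(V)` of the unique extension of `v* ∈ V*` to an algebra
homomorphism `S(V) → ℝ`. -/
def hat (f : SymmetricAlgebra ℝ V) (v : AlgDual V) : ℝ :=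
  SymmetricAlgebra.lift v.toLin f

/-- The dual norm `ρ'(v*) = inf {C ∈ [0,∞) : |v*(w)| ≤ C ρ(w) for all w}`, with value `∞` if
there is no such `C`. -/
def dualNorm (ρ : Seminorm ℝ V) (v : AlgDual V) : ℝ≥0∞ :=
  ⨅ (C : ℝ≥0) (_ : ∀ w : V, |v.toLin w| ≤ C * ρ w), (C : ℝ≥0∞)

/-- The closed unit ball of the dual norm. -/
def dualBall (ρ : Seminorm ℝ V) : Set (AlgDual V) :=
  {v | dualNorm ρ v ≤ 1}

/-- `X_M`, as a subset of `V*` (the character space of `S(V)`). -/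
def nonnegSet (M : Set (SymmetricAlgebra ℝ V)) : Set (AlgDual V) :=
  {v | ∀ g ∈ M, 0 ≤ hat g v}

/-! ### Radon measures and integral representations -/

/-- Positive Radon measures on a topological space with its Borel σ-algebra: locally finite
and inner regular with respect to compact sets. -/
structure IsRadon {X : Type*} [TopologicalSpace X] [MeasurableSpace X]
    (μ : Measure X) : Prop where
  locallyFinite : IsLocallyFiniteMeasure μ
  innerRegular : μ.InnerRegular

/-- `μ` is supported by `Y`. -/
def IsSupportedBy {X : Type*} [MeasurableSpace X] (μ : Measure X) (Y : Set X) : Prop :=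
  μ Yᶜ = 0

/-- `L(f) = ∫ f̂ dμ` for all `f ∈ S(V)` (all these integrals being finite). -/
def Represents (L : SymmetricAlgebra ℝ V →ₗ[ℝ] ℝ) (μ : Measure (AlgDual V)) : Prop :=
  ∀ f, Integrable (hat f) μ ∧ L f = ∫ v, hat f v ∂μ

/-- The `ρ̄`-continuous linear functionals on `S(V)` that are nonnegative on `∑ S(V)^{2d}`. -/
abbrev PosFunctional (ρ : Seminorm ℝ V) (d : ℕ) : Type _ :=
  {L : SymmetricAlgebra ℝ V →ₗ[ℝ] ℝ //
    IsProjContinuous ρ L ∧ IsPositiveOn (sumPow (SymmetricAlgebra ℝ V) (2 * d)) L}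

/-- The positive Radon measures on `V*` that are supported by the closed unit ball of `ρ'`. -/
abbrev BallMeasure (ρ : Seminorm ℝ V) : Type _ :=
  {μ : Measure (AlgDual V) // IsRadon μ ∧ IsSupportedBy μ (dualBall ρ)}

end SymMoment

end

/-! A `ρ̄`-continuous `L` is also bounded for the largest submultiplicative seminorm `mulExt ρ`
(`abs_le_mulExt`), so positivity can be studied in a seminormed algebra. There the elements near 1
are limits of `2d`-th powers, and so are their products; hence `L ≥ 0` on the monoid `nearOne` that
they generate. The normalized functionals nonnegative on this monoid form a compact convex set whose
extreme points are characters. By Krein–Milman, `L` is nonnegative wherever all contractive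
characters are (`nonneg_of_forall_character_nonneg`).

On S(V) such characters restrict to points of the dual ball, which is compact. Riesz extension and
Riesz–Markov on the ball give `μ`, and Stone–Weierstrass makes it unique. Conversely, `|f̂| ≤ ρ̄(f)`
on the ball makes integration against `μ` continuous.

For a power module, testing `L` on `a^(2d) g`, with `â` approximating the `2d`-th root of the
negative part of `ĝ`, shows that `{ĝ < 0}` is null; inner regularity handles all `g ∈ M` at once. -/

namespace SymMoment

/-! ### Seminormed algebras: approximate roots, states and characters. -/

section Abstract

open Filter Topology

variable {A : Type*} [SeminormedCommRing A]

/-- The multiplicative monoid generated by the ball of radius `c` around `1`. -/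
def nearOne (A : Type*) [SeminormedCommRing A] (c : ℝ) : Submonoid A :=
  Submonoid.closure {a | ‖a - 1‖ < c}

theorem one_add_mem_nearOne {c : ℝ} {x : A} (hx : ‖x‖ < c) : 1 + x ∈ nearOne A c :=
  Submonoid.subset_closure (by simpa using hx)

theorem one_sub_mem_nearOne {c : ℝ} {x : A} (hx : ‖x‖ < c) : 1 - x ∈ nearOne A c := by
  simpa [sub_eq_add_neg] using one_add_mem_nearOne (x := -x) (by simpa using hx)

/-- By commutativity the `n`-th powers form a submonoid, and so does their closure; it suffices to
check generators. -/
theorem exists_pow_near_of_mem_nearOne {n : ℕ} {c : ℝ}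
    (hc : ∀ a : A, ‖a - 1‖ < c → ∀ ε : ℝ, 0 < ε → ∃ b : A, ‖b ^ n - a‖ < ε)
    {a : A} (ha : a ∈ nearOne A c) : ∀ ε : ℝ, 0 < ε → ∃ b : A, ‖b ^ n - a‖ < ε := by
  have key (a : A) : (∀ ε : ℝ, 0 < ε → ∃ b : A, ‖b ^ n - a‖ < ε) ↔
      a ∈ closure (Set.range fun b : A => b ^ n) := by
    simp [Metric.mem_closure_range_iff, dist_eq_norm, norm_sub_rev a]
  rw [key]
  have hle : nearOne A c ≤ (MonoidHom.mrange (powMonoidHom n : A →* A)).topologicalClosure := by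
    rw [nearOne, Submonoid.closure_le]
    intro x hx
    exact (key x).1 (hc x hx)
  exact hle ha

variable [NormedAlgebra ℝ A]

/-- Elements close to `1` in a complete normed algebra are `n`-th powers. -/
theorem eventually_exists_pow_eq {B : Type*} [NormedCommRing B] [NormedAlgebra ℝ B]
    [CompleteSpace B] {n : ℕ} (hn : n ≠ 0) : ∀ᶠ y in 𝓝 (1 : B), ∃ b : B, b ^ n = y := by
  have h := (hasStrictFDerivAt_id (𝕜 := ℝ) (1 : B)).pow n
  have hn' : (n : ℝ) ≠ 0 := by exact_mod_cast hn
  -- The derivative of `b ↦ b ^ n` at 1 is multiplication by `n`, which is onto, so the map is open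
  -- at 1.
  have hmap := h.map_nhds_eq_of_surj (by
    rw [LinearMap.range_eq_top]
    intro y
    refine ⟨(n : ℝ)⁻¹ • y, ?_⟩
    simp only [id, one_pow, ContinuousLinearMap.coe_coe, smul_apply, map_smul,
      ContinuousLinearMap.id_apply, smul_eq_mul, nsmul_eq_mul, mul_one]
    rw [← nsmul_eq_mul, ← Nat.cast_smul_eq_nsmul ℝ, smul_smul, inv_mul_cancel₀ hn', one_smul])
  have : Set.range (fun b : B => b ^ n) ∈ map (fun b : B => b ^ n) (𝓝 1) := by
    rw [mem_map]
    exact Filter.mem_of_superset univ_mem fun x _ => Set.mem_range_self x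
  simp only [id] at hmap
  rw [hmap, one_pow] at this
  exact this

/-- In a seminormed algebra, elements close to `1` are limits of `n`-th powers. -/
theorem exists_pow_near_of_near_one {n : ℕ} (hn : n ≠ 0) :
    ∃ c : ℝ, 0 < c ∧ ∀ a : A, ‖a - 1‖ < c → ∀ ε : ℝ, 0 < ε → ∃ b : A, ‖b ^ n - a‖ < ε := by
  -- `A` need not be complete or separated: an exact root is found in the completion, then
  -- approximated from the dense image of `A`.
  obtain ⟨c, hc, hball⟩ := Metric.eventually_nhds_iff.1
    (eventually_exists_pow_eq (B := UniformSpace.Completion A) hn)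
  refine ⟨c, hc, fun a ha ε hε => ?_⟩
  obtain ⟨y, hy⟩ := hball (y := (a : UniformSpace.Completion A)) (by
    rw [dist_eq_norm, ← UniformSpace.Completion.coe_one, ← UniformSpace.Completion.coe_sub,
      UniformSpace.Completion.norm_coe]
    exact ha)
  have hopen : IsOpen {z : UniformSpace.Completion A | ‖z ^ n - a‖ < ε} :=
    isOpen_lt (by fun_prop) continuous_const
  obtain ⟨b, hb⟩ := UniformSpace.Completion.denseRange_coe.exists_mem_open hopen
    ⟨y, by simpa [hy] using hε⟩
  refine ⟨b, ?_⟩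
  have hpow : ((b ^ n : A) : UniformSpace.Completion A) = (b : UniformSpace.Completion A) ^ n :=
    map_pow (UniformSpace.Completion.coeRingHom (α := A)) b n
  simpa only [Set.mem_ofPred_eq, ← hpow, ← UniformSpace.Completion.coe_sub,
    UniformSpace.Completion.norm_coe] using hb

theorem nonneg_of_mem_nearOne {n : ℕ} {c : ℝ}
    (hc : ∀ a : A, ‖a - 1‖ < c → ∀ ε : ℝ, 0 < ε → ∃ b : A, ‖b ^ n - a‖ < ε)
    {L : A →ₗ[ℝ] ℝ} {C : ℝ} (hL : ∀ a, |L a| ≤ C * ‖a‖) (hpos : ∀ a, 0 ≤ L (a ^ n))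
    {a : A} (ha : a ∈ nearOne A c) : 0 ≤ L a := by
  by_contra! hneg
  have hC : 0 ≤ |C| + 1 := by positivity
  -- At this tolerance `L (b ^ n)` would still be negative; `|C| + 1` keeps the denominator
  -- positive.
  obtain ⟨b, hb⟩ := exists_pow_near_of_mem_nearOne hc ha (-L a / (|C| + 1))
    (div_pos (by linarith) (by positivity))
  rw [lt_div_iff₀ (by positivity)] at hb
  have h1 := hL (b ^ n - a)
  have h2 : C * ‖b ^ n - a‖ ≤ ‖b ^ n - a‖ * (|C| + 1) := by
    nlinarith [norm_nonneg (b ^ n - a), le_abs_self C]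
  have h3 := le_abs_self (L (b ^ n - a))
  rw [map_sub] at h3 h1
  have := hpos b
  linarith

/-- Both `1 ± t • x` lie in `nearOne` for `t = c / (‖x‖ + 1)`, so `t |φ x| ≤ φ 1`. The `+ 1` covers
`‖x‖ = 0`. -/
theorem abs_le_of_nonneg_nearOne {c : ℝ} (hc : 0 < c) {φ : A →ₗ[ℝ] ℝ}
    (hφ : ∀ a ∈ nearOne A c, 0 ≤ φ a) (x : A) : |φ x| ≤ (‖x‖ + 1) / c * φ 1 := by
  have hx : 0 < ‖x‖ + 1 := by positivity
  set t := c / (‖x‖ + 1) with ht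
  have htpos : 0 < t := by positivity
  have hlt : ‖t • x‖ < c := by
    rw [norm_smul, Real.norm_of_nonneg htpos.le, ht, div_mul_eq_mul_div, div_lt_iff₀ hx]
    nlinarith
  have h1 := hφ _ (one_add_mem_nearOne hlt)
  have h2 := hφ _ (one_sub_mem_nearOne hlt)
  simp only [map_add, map_sub, map_smul, smul_eq_mul] at h1 h2
  have h3 : t * |φ x| ≤ φ 1 := by
    rw [← abs_of_pos htpos, ← abs_mul, abs_le]
    constructor <;> linarith
  rw [← inv_div, ← ht, inv_mul_eq_div, le_div_iff₀ htpos]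
  linarith

/-- The normalized linear functionals that are nonnegative on `nearOne A c`. -/
def stateSet (A : Type*) [SeminormedCommRing A] [NormedAlgebra ℝ A] (c : ℝ) : Set (A → ℝ) :=
  {φ | IsLinearMap ℝ φ ∧ φ 1 = 1 ∧ ∀ a ∈ nearOne A c, 0 ≤ φ a}

theorem isCompact_stateSet {c : ℝ} (hc : 0 < c) : IsCompact (stateSet A c) := by
  refine (isCompact_univ_pi fun x : A =>
    isCompact_Icc (a := -((‖x‖ + 1) / c)) (b := (‖x‖ + 1) / c)).of_isClosed_subset ?_ ?_
  · have : stateSet A c = {φ | ∀ x y, φ (x + y) = φ x + φ y} ∩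
        {φ | ∀ (t : ℝ) x, φ (t • x) = t • φ x} ∩ {φ | φ 1 = 1} ∩
        {φ | ∀ a ∈ nearOne A c, 0 ≤ φ a} := by
      ext φ
      constructor
      · rintro ⟨h1, h2, h3⟩
        exact ⟨⟨⟨h1.map_add, h1.map_smul⟩, h2⟩, h3⟩
      · rintro ⟨⟨⟨h1, h1'⟩, h2⟩, h3⟩
        exact ⟨⟨h1, h1'⟩, h2, h3⟩
    rw [this]
    refine ((IsClosed.inter ?_ ?_).inter ?_).inter ?_
    · simp only [Set.ofPred_forall]
      exact isClosed_iInter fun x => isClosed_iInter fun y =>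
        isClosed_eq (by fun_prop) (by fun_prop)
    · simp only [Set.ofPred_forall]
      exact isClosed_iInter fun x => isClosed_iInter fun y =>
        isClosed_eq (by fun_prop) (by fun_prop)
    · exact isClosed_eq (by fun_prop) (by fun_prop)
    · simp only [Set.ofPred_forall]
      exact isClosed_iInter fun x => isClosed_iInter fun y =>
        isClosed_le (by fun_prop) (by fun_prop)
  · rintro φ ⟨h1, h2, h3⟩ x -
    have := abs_le_of_nonneg_nearOne hc (φ := h1.mk' φ) h3 x
    simp only [IsLinearMap.mk'_apply, h2, mul_one] at this
    exact abs_le.1 this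

theorem convex_stateSet (c : ℝ) : Convex ℝ (stateSet A c) := by
  rintro φ ⟨h1, h2, h3⟩ ψ ⟨h1', h2', h3'⟩ s t hs ht hst
  refine ⟨⟨fun x y => ?_, fun r x => ?_⟩, ?_, fun a ha => ?_⟩
  · simp [h1.map_add, h1'.map_add]; ring
  · simp [h1.map_smul, h1'.map_smul]; ring
  · simp [h2, h2', hst]
  · have := h3 a ha
    have := h3' a ha
    simp only [Pi.add_apply, Pi.smul_apply, smul_eq_mul]
    positivity

/-- This is where closure of `nearOne` under products is needed. -/
theorem mul_mem_stateSet {c : ℝ} {φ : A → ℝ} (hφ : φ ∈ stateSet A c) {p : A}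
    (hp : p ∈ nearOne A c) (hpos : 0 < φ p) :
    (fun f => (φ p)⁻¹ * φ (p * f)) ∈ stateSet A c := by
  obtain ⟨h1, h2, h3⟩ := hφ
  refine ⟨⟨fun x y => ?_, fun r x => ?_⟩, ?_, fun a ha => ?_⟩
  · simp [mul_add, h1.map_add]
  · simp [h1.map_smul]; ring
  · simp [hpos.ne']
  · exact mul_nonneg (inv_nonneg.2 hpos.le) (h3 _ (mul_mem hp ha))

/-- `φ` is a convex combination of the states `f ↦ φ (p * f) / φ p` for `p = 1 ± t • x`, with
weights `φ p / 2`. Extremality makes them equal to `φ`, which is multiplicativity. -/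
theorem map_mul_of_mem_extremePoints {c : ℝ} (hc : 0 < c) {φ : A → ℝ}
    (hφ : φ ∈ (stateSet A c).extremePoints ℝ) (x f : A) : φ (x * f) = φ x * φ f := by
  obtain ⟨hmem, hext⟩ := mem_extremePoints.1 hφ
  obtain ⟨h1, h2, h3⟩ := id hmem
  set b := (‖x‖ + 1) / c with hb
  have hbpos : 0 < b := by positivity
  -- Small enough for both `‖t • x‖ < c` and `|t * φ x| < 1`.
  set t : ℝ := (2 * (b + (‖x‖ + 1) / c))⁻¹ with ht
  have htpos : 0 < t := by positivity
  have hbd : |φ x| ≤ b := by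
    simpa [h2] using abs_le_of_nonneg_nearOne hc (φ := h1.mk' φ) h3 x
  have hlt : ‖t • x‖ < c := by
    rw [norm_smul, Real.norm_of_nonneg htpos.le, ht, inv_mul_lt_iff₀ (by positivity), hb]
    field_simp
    nlinarith [norm_nonneg x]
  have htx : |t * φ x| < 1 := by
    rw [abs_mul, abs_of_pos htpos, ht, inv_mul_lt_iff₀ (by positivity)]
    have : 0 < (‖x‖ + 1) / c := by positivity
    linarith
  obtain ⟨htx1, htx2⟩ := abs_lt.1 htx
  have e1 : φ (1 + t • x) = 1 + t * φ x := by rw [h1.map_add, h1.map_smul, h2, smul_eq_mul]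
  have e2 : φ (1 - t • x) = 1 - t * φ x := by rw [h1.map_sub, h1.map_smul, h2, smul_eq_mul]
  have p1 : 0 < φ (1 + t • x) := by rw [e1]; linarith
  have p2 : 0 < φ (1 - t • x) := by rw [e2]; linarith
  have key := hext _ (mul_mem_stateSet hmem (one_add_mem_nearOne hlt) p1) _
    (mul_mem_stateSet hmem (one_sub_mem_nearOne hlt) p2)
    ⟨φ (1 + t • x) / 2, φ (1 - t • x) / 2, by linarith, by linarith, by rw [e1, e2]; ring, by
      ext g
      simp only [Pi.add_apply, Pi.smul_apply, smul_eq_mul]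
      have : φ ((1 + t • x) * g) + φ ((1 - t • x) * g) = 2 * φ g := by
        rw [← h1.map_add, ← add_mul]
        have : (1 + t • x + (1 - t • x)) * g = (2 : ℝ) • g := by
          rw [two_smul]; ring
        rw [this, h1.map_smul, smul_eq_mul]
      field_simp
      linarith⟩
  have : (φ (1 + t • x))⁻¹ * φ ((1 + t • x) * f) = φ f := congrFun key.1 f
  rw [inv_mul_eq_iff_eq_mul₀ p1.ne', e1, add_mul, one_mul, h1.map_add, smul_mul_assoc,
    h1.map_smul, smul_eq_mul] at this
  have : t * (φ (x * f) - φ x * φ f) = 0 := by linarith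
  have := (mul_eq_zero.1 this).resolve_left htpos.ne'
  linarith

/-- If `|α x| > ‖x‖`, a rescaled `x` has norm at most 1 and `|α x| > 1`; its powers then violate the
bound. -/
theorem AlgHom.abs_le_norm_of_abs_le {b : ℝ} {α : A →ₐ[ℝ] ℝ}
    (hα : ∀ x, |α x| ≤ (‖x‖ + 1) * b) (x : A) : |α x| ≤ ‖x‖ := by
  by_contra! hlt
  obtain ⟨r, hr1, hr2⟩ := exists_between hlt
  have hr : 0 < r := (norm_nonneg x).trans_lt hr1
  have hb : 0 ≤ b := by
    have := (abs_nonneg _).trans (hα x)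
    exact nonneg_of_mul_nonneg_right this (by positivity)
  have hbig : 1 < |α (r⁻¹ • x)| := by
    rw [map_smul, smul_eq_mul, abs_mul, abs_of_pos (inv_pos.2 hr), inv_mul_eq_div,
      one_lt_div hr]
    exact hr2
  have hsmall : ‖r⁻¹ • x‖ ≤ 1 := by
    rw [norm_smul, Real.norm_of_nonneg (inv_pos.2 hr).le, inv_mul_le_one₀ hr]
    exact hr1.le
  obtain ⟨m, hm⟩ := pow_unbounded_of_one_lt (2 * b) hbig
  -- The exponent must be positive, since `‖1‖ ≤ 1` is not assumed.
  have hm' : 2 * b < |α (r⁻¹ • x)| ^ (m + 1) :=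
    hm.trans_le (pow_le_pow_right₀ hbig.le m.le_succ)
  have h1 := hα ((r⁻¹ • x) ^ (m + 1))
  rw [map_pow, abs_pow] at h1
  have h2 : ‖(r⁻¹ • x) ^ (m + 1)‖ ≤ 1 :=
    (norm_pow_le' _ m.succ_pos).trans (pow_le_one₀ (norm_nonneg _) hsmall)
  nlinarith

/-- A bounded linear functional that is nonnegative on `n`-th powers is nonnegative on every
element on which all contractive characters are nonnegative. -/
theorem nonneg_of_forall_character_nonneg {n : ℕ} (hn : n ≠ 0) {L : A →ₗ[ℝ] ℝ} {C : ℝ}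
    (hL : ∀ a, |L a| ≤ C * ‖a‖) (hpos : ∀ a, 0 ≤ L (a ^ n)) {f : A}
    (hf : ∀ α : A →ₐ[ℝ] ℝ, (∀ a, |α a| ≤ ‖a‖) → 0 ≤ α f) : 0 ≤ L f := by
  obtain ⟨c, hc, hroot⟩ := exists_pow_near_of_near_one (A := A) hn
  have hnear (a) (ha : a ∈ nearOne A c) : 0 ≤ L a := nonneg_of_mem_nearOne hroot hL hpos ha
  have h1 : 0 ≤ L 1 := hnear 1 (one_mem _)
  -- If `L 1 = 0`, the bound forces `L f = 0`; otherwise `L` can be normalized to a state.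
  rcases h1.eq_or_lt with h0 | h1
  · have := abs_le_of_nonneg_nearOne hc hnear f
    rw [← h0, mul_zero] at this
    exact (abs_nonpos_iff.1 this).ge
  have hstate : (fun a => (L 1)⁻¹ * L a) ∈ stateSet A c :=
    ⟨⟨fun x y => by simp [mul_add], fun r x => by simp; ring⟩, inv_mul_cancel₀ h1.ne',
      fun a ha => mul_nonneg (inv_nonneg.2 h1.le) (hnear a ha)⟩
  rw [← closure_convexHull_extremePoints (isCompact_stateSet hc) (convex_stateSet c)] at hstate
  have hsub : closure (convexHull ℝ ((stateSet A c).extremePoints ℝ)) ⊆ {φ | 0 ≤ φ f} := by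
    refine closure_minimal (convexHull_min ?_ ?_) (isClosed_le (by fun_prop) (by fun_prop))
    · intro φ hφ
      obtain ⟨g1, g2, g3⟩ := (mem_extremePoints.1 hφ).1
      have hbd (x : A) : |φ x| ≤ (‖x‖ + 1) * c⁻¹ := by
        simpa [g2, div_eq_mul_inv] using abs_le_of_nonneg_nearOne hc (φ := g1.mk' φ) g3 x
      let α : A →ₐ[ℝ] ℝ := AlgHom.ofLinearMap (g1.mk' φ) g2
        (map_mul_of_mem_extremePoints hc hφ)
      exact hf α (AlgHom.abs_le_norm_of_abs_le (b := c⁻¹) hbd)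
    · intro φ hφ ψ hψ s t hs ht _
      simp only [Set.mem_ofPred_eq, Pi.add_apply, Pi.smul_apply, smul_eq_mul] at hφ hψ ⊢
      positivity
  have := hsub hstate
  exact nonneg_of_mul_nonneg_right this (inv_pos.2 h1)

end Abstract

/-! ### The projective extension and the largest submultiplicative extension. -/

section ProjectiveSeminorm

variable {V : Type*} [AddCommGroup V] [Module ℝ V] {ρ : Seminorm ℝ V}

/-- `ProjBound ρ f r` says that `f` has an expression in terms of scalars and elements of `V` from
which submultiplicativity, subadditivity and `ρ` give the upper bound `r`. -/
inductive ProjBound (ρ : Seminorm ℝ V) : SymmetricAlgebra ℝ V → ℝ → Prop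
  | scalar (t : ℝ) : ProjBound ρ (algebraMap ℝ _ t) |t|
  | ι (v : V) : ProjBound ρ (SymmetricAlgebra.ι ℝ V v) (ρ v)
  | add {f g r s} : ProjBound ρ f r → ProjBound ρ g s → ProjBound ρ (f + g) (r + s)
  | mul {f g r s} : ProjBound ρ f r → ProjBound ρ g s → ProjBound ρ (f * g) (r * s)

theorem ProjBound.nonneg {f : SymmetricAlgebra ℝ V} {r : ℝ} (h : ProjBound ρ f r) : 0 ≤ r := by
  induction h with
  | scalar t => exact abs_nonneg t
  | ι v => exact apply_nonneg ρ v
  | add _ _ h1 h2 => exact add_nonneg h1 h2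
  | mul _ _ h1 h2 => exact mul_nonneg h1 h2

theorem ProjBound.exists (ρ : Seminorm ℝ V) (f : SymmetricAlgebra ℝ V) :
    ∃ r, ProjBound ρ f r := by
  induction f using SymmetricAlgebra.induction with
  | algebraMap t => exact ⟨_, .scalar t⟩
  | ι v => exact ⟨_, .ι v⟩
  | mul f g hf hg =>
    obtain ⟨r, hr⟩ := hf
    obtain ⟨s, hs⟩ := hg
    exact ⟨_, hr.mul hs⟩
  | add f g hf hg =>
    obtain ⟨r, hr⟩ := hf
    obtain ⟨s, hs⟩ := hg
    exact ⟨_, hr.add hs⟩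

theorem ProjBound.smul {f : SymmetricAlgebra ℝ V} {r : ℝ} (t : ℝ) (h : ProjBound ρ f r) :
    ProjBound ρ (t • f) (|t| * r) := by
  rw [Algebra.smul_def]
  exact (ProjBound.scalar t).mul h

/-- The largest submultiplicative seminorm on `S(V)` that extends the absolute value on `ℝ` and
is bounded by `ρ` on `V`. -/
noncomputable def mulExt (ρ : Seminorm ℝ V) (f : SymmetricAlgebra ℝ V) : ℝ :=
  sInf {r | ProjBound ρ f r}

theorem mulExt_le {f : SymmetricAlgebra ℝ V} {r : ℝ} (h : ProjBound ρ f r) : mulExt ρ f ≤ r :=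
  csInf_le ⟨0, fun _ h => h.nonneg⟩ h

theorem le_mulExt {f : SymmetricAlgebra ℝ V} {b : ℝ} (h : ∀ r, ProjBound ρ f r → b ≤ r) :
    b ≤ mulExt ρ f :=
  le_csInf (ProjBound.exists ρ f) h

theorem mulExt_nonneg (f : SymmetricAlgebra ℝ V) : 0 ≤ mulExt ρ f :=
  le_mulExt fun _ h => h.nonneg

theorem mulExt_add_le (f g : SymmetricAlgebra ℝ V) :
    mulExt ρ (f + g) ≤ mulExt ρ f + mulExt ρ g := by
  rw [← sub_le_iff_le_add]
  refine le_mulExt fun r hr => ?_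
  rw [sub_le_comm]
  refine le_mulExt fun s hs => ?_
  rw [sub_le_iff_le_add']
  exact mulExt_le (hr.add hs)

theorem mulExt_smul_le (t : ℝ) (f : SymmetricAlgebra ℝ V) :
    mulExt ρ (t • f) ≤ |t| * mulExt ρ f := by
  rcases eq_or_ne t 0 with rfl | ht
  · simpa using mulExt_le (ρ := ρ) (.scalar (0 : ℝ) : ProjBound ρ _ _)
  · rw [← div_le_iff₀' (abs_pos.2 ht)]
    refine le_mulExt fun r hr => ?_
    rw [div_le_iff₀' (abs_pos.2 ht)]
    exact mulExt_le (hr.smul t)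

theorem mulExt_mul_le (f g : SymmetricAlgebra ℝ V) :
    mulExt ρ (f * g) ≤ mulExt ρ f * mulExt ρ g := by
  refine le_of_forall_pos_le_add fun ε hε => ?_
  have hcont : Filter.Tendsto (fun δ : ℝ => (mulExt ρ f + δ) * (mulExt ρ g + δ))
      (nhdsWithin 0 (Set.Ioi 0)) (nhds (mulExt ρ f * mulExt ρ g)) := by
    have : Continuous fun δ : ℝ => (mulExt ρ f + δ) * (mulExt ρ g + δ) := by fun_prop
    simpa using (this.tendsto 0).mono_left nhdsWithin_le_nhds
  obtain ⟨δ, hδ, hpos⟩ := ((hcont.eventually_lt_const (lt_add_of_pos_right _ hε)).and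
    self_mem_nhdsWithin).exists
  obtain ⟨r, hr, hr'⟩ := exists_lt_of_csInf_lt (ProjBound.exists ρ f)
    (lt_add_of_pos_right (mulExt ρ f) hpos)
  obtain ⟨s, hs, hs'⟩ := exists_lt_of_csInf_lt (ProjBound.exists ρ g)
    (lt_add_of_pos_right (mulExt ρ g) hpos)
  refine (mulExt_le (ProjBound.mul hr hs)).trans (le_trans ?_ hδ.le)
  have := ProjBound.nonneg hr
  have := ProjBound.nonneg hs
  have := mulExt_nonneg (ρ := ρ) f
  gcongr

/-- `S(V)` as a seminormed ring. -/
@[reducible]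
noncomputable def mulExtSeminormedCommRing (ρ : Seminorm ℝ V) :
    SeminormedCommRing (SymmetricAlgebra ℝ V) where
  __ := (inferInstance : CommRing (SymmetricAlgebra ℝ V))
  __ := AddGroupSeminorm.toSeminormedAddCommGroup (E := SymmetricAlgebra ℝ V)
    { toFun := mulExt ρ
      map_zero' := le_antisymm (by simpa using mulExt_smul_le (ρ := ρ) 0 0) (mulExt_nonneg _)
      add_le' := mulExt_add_le
      neg' := by
        have (f : SymmetricAlgebra ℝ V) : mulExt ρ (-f) ≤ mulExt ρ f := by
          simpa using mulExt_smul_le (ρ := ρ) (-1) f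
        exact fun f => le_antisymm (this f) (by simpa using this (-f)) }
  norm_mul_le := mulExt_mul_le

theorem prod_ι_mem_homPart (l : List V) :
    (l.map (SymmetricAlgebra.ι ℝ V)).prod ∈ homPart V l.length := by
  induction l with
  | nil => simp [homPart]
  | cons v l ih =>
    rw [List.map_cons, List.prod_cons, List.length_cons, homPart, pow_succ']
    exact Submodule.mul_mem_mul (LinearMap.mem_range_self _ v) ih

theorem projHom_nonneg (k : ℕ) (f : homPart V k) : 0 ≤ projHom ρ k f := by
  cases k with
  | zero => exact abs_nonneg _
  | succ k =>
    refine Real.sInf_nonneg ?_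
    rintro _ ⟨n, g, -, -, rfl⟩
    exact Finset.sum_nonneg fun i _ => Finset.prod_nonneg fun j _ => apply_nonneg ρ _

/-- Makes the set in `projHom` nonempty; for an empty set `sInf` would be 0 and bound nothing from
above. -/
theorem exists_eq_sum_prod_ι {k : ℕ} {f : SymmetricAlgebra ℝ V} (hf : f ∈ homPart V (k + 1)) :
    ∃ (n : ℕ) (g : Fin n → Fin (k + 1) → V), 1 ≤ n ∧
      f = ∑ i, ∏ j, SymmetricAlgebra.ι ℝ V (g i j) := by
  rw [homPart, ← Submodule.span_eq (LinearMap.range (SymmetricAlgebra.ι ℝ V)),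
    Submodule.span_pow] at hf
  induction hf using Submodule.span_induction with
  | mem f hf =>
    obtain ⟨h, rfl⟩ := Set.mem_pow.1 hf
    choose g hg using fun i => (h i).2
    exact ⟨1, fun _ => g, le_rfl, by
      rw [Fin.sum_univ_one, List.prod_ofFn]
      simp only [hg]⟩
  | zero => exact ⟨1, fun _ _ => 0, le_rfl, by simp⟩
  | add f f' _ _ ih ih' =>
    obtain ⟨n, g, hn, rfl⟩ := ih
    obtain ⟨n', g', -, rfl⟩ := ih'
    exact ⟨n + n', Fin.append g g', by omega, by simp [Fin.sum_univ_add]⟩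
  | smul t f _ ih =>
    obtain ⟨n, g, hn, rfl⟩ := ih
    refine ⟨n, fun i => Fin.cons (t • g i 0) fun j => g i j.succ, hn, ?_⟩
    simp [Fin.prod_univ_succ, Finset.smul_sum]

theorem projExt_prod_ι_le (ρ : Seminorm ℝ V) (l : List V) :
    projExt ρ (l.map (SymmetricAlgebra.ι ℝ V)).prod ≤ (l.map ρ).prod := by
  classical
  have hρ : 0 ≤ (l.map ρ).prod := List.prod_nonneg fun r hr => by
    obtain ⟨v, -, rfl⟩ := List.mem_map.1 hr
    exact apply_nonneg ρ v
  have hmem := prod_ι_mem_homPart l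
  set f := (l.map (SymmetricAlgebra.ι ℝ V)).prod with hf
  have hdec := DirectSum.decompose_of_mem (homPart V) hmem
  have hterm : projHom ρ l.length ⟨f, hmem⟩ ≤ (l.map ρ).prod := by
    rcases l with _ | ⟨v, l⟩
    · simp [projHom, hf]
    · refine csInf_le ⟨0, ?_⟩ ⟨1, fun _ => (v :: l).get, le_rfl, ?_, ?_⟩
      · rintro _ ⟨n, g, -, -, rfl⟩
        exact Finset.sum_nonneg fun i _ => Finset.prod_nonneg fun j _ => apply_nonneg ρ _
      · simp only [Finset.univ_unique, Finset.sum_singleton]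
        exact (Fin.prod_univ_fun_getElem (v :: l) (SymmetricAlgebra.ι ℝ V)).symm
      · simp only [Finset.univ_unique, Finset.sum_singleton]
        exact (Fin.prod_univ_fun_getElem (v :: l) ρ).symm
  rw [projExt]
  refine (Finset.sum_le_sum_of_subset_of_nonneg (t := {l.length}) ?_
    fun k _ _ => projHom_nonneg k _).trans ?_
  · rw [hdec]
    exact DFinsupp.support_single_subset
  · rw [Finset.sum_singleton, hdec, DirectSum.of_eq_same]
    exact hterm

/-- The factor `h` and the list `l` serve the induction: a product applies one hypothesis to the
output of the other, and a vector moves into `l`. Thus `projExt` need only be estimated on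
monomials. -/
theorem abs_le_of_projBound {L : SymmetricAlgebra ℝ V →ₗ[ℝ] ℝ} {f : SymmetricAlgebra ℝ V} {r : ℝ}
    (hf : ProjBound ρ f r) {h : SymmetricAlgebra ℝ V} {s : ℝ}
    (hh : ∀ l : List V, |L (h * (l.map (SymmetricAlgebra.ι ℝ V)).prod)| ≤ s * (l.map ρ).prod)
    (l : List V) :
    |L (f * h * (l.map (SymmetricAlgebra.ι ℝ V)).prod)| ≤ r * s * (l.map ρ).prod := by
  induction hf generalizing h s l with
  | scalar t =>
    rw [← Algebra.smul_def, smul_mul_assoc, map_smul, smul_eq_mul, abs_mul, mul_assoc]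
    exact mul_le_mul_of_nonneg_left (hh l) (abs_nonneg t)
  | ι v =>
    have := hh (v :: l)
    rw [List.map_cons, List.map_cons, List.prod_cons, List.prod_cons] at this
    convert this using 1
    · congr 2; ring
    · ring
  | add _ _ ih1 ih2 =>
    rw [add_mul, add_mul, map_add, add_mul, add_mul]
    exact (abs_add_le _ _).trans (add_le_add (ih1 hh l) (ih2 hh l))
  | mul _ _ ih1 ih2 =>
    rw [mul_assoc _ _ h, mul_assoc _ _ s]
    exact ih1 (ih2 hh) l

theorem abs_le_mulExt {L : SymmetricAlgebra ℝ V →ₗ[ℝ] ℝ} {C : ℝ} (hC : 0 < C)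
    (hL : ∀ f, |L f| ≤ C * projExt ρ f) (f : SymmetricAlgebra ℝ V) :
    |L f| ≤ C * mulExt ρ f := by
  rw [← div_le_iff₀' hC]
  refine le_mulExt fun r hr => ?_
  rw [div_le_iff₀ hC]
  have h1 (l : List V) : |L (1 * (l.map (SymmetricAlgebra.ι ℝ V)).prod)| ≤ C * (l.map ρ).prod := by
    rw [one_mul]
    exact (hL _).trans (mul_le_mul_of_nonneg_left (projExt_prod_ι_le ρ l) hC.le)
  simpa using abs_le_of_projBound hr h1 []

theorem mem_dualBall_iff {v : AlgDual V} : v ∈ dualBall ρ ↔ ∀ w, |v.toLin w| ≤ ρ w := by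
  constructor
  · intro h w
    -- The infimum is not known to be attained, so `c` decreases to 1.
    have hcont : Filter.Tendsto (fun c : ℝ => c * ρ w) (nhdsWithin 1 (Set.Ioi 1))
        (nhds (1 * ρ w)) :=
      ((continuous_id.mul continuous_const).tendsto 1).mono_left nhdsWithin_le_nhds
    rw [one_mul] at hcont
    refine ge_of_tendsto hcont ?_
    filter_upwards [self_mem_nhdsWithin] with c hc
    have hlt : dualNorm ρ v < ENNReal.ofReal c :=
      lt_of_le_of_lt h (by simpa using hc)
    simp only [dualNorm, iInf_lt_iff] at hlt
    obtain ⟨C, hC, hCc⟩ := hlt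
    have hCc' : (C : ℝ) ≤ c := by
      have := (ENNReal.lt_ofReal_iff_toReal_lt ENNReal.coe_ne_top).1 hCc
      exact this.le
    exact (hC w).trans (mul_le_mul_of_nonneg_right hCc' (apply_nonneg ρ w))
  · intro h
    exact (iInf₂_le (f := fun (C : ℝ≥0) (_ : ∀ w : V, |v.toLin w| ≤ C * ρ w) => (C : ℝ≥0∞)) 1
      (by simpa using h)).trans (by simp)

/-- A `ρ̄`-continuous functional that is nonnegative on `n`-th powers is nonnegative on every
element of `S(V)` that is nonnegative on the dual unit ball. -/
theorem nonneg_of_forall_mem_dualBall {n : ℕ} (hn : n ≠ 0) {L : SymmetricAlgebra ℝ V →ₗ[ℝ] ℝ}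
    (hL : IsProjContinuous ρ L) (hpos : ∀ a, 0 ≤ L (a ^ n)) {f : SymmetricAlgebra ℝ V}
    (hf : ∀ v ∈ dualBall ρ, 0 ≤ hat f v) : 0 ≤ L f := by
  obtain ⟨C, hC, hL⟩ := hL
  let := mulExtSeminormedCommRing ρ
  let : NormedAlgebra ℝ (SymmetricAlgebra ℝ V) :=
    { (inferInstance : Algebra ℝ (SymmetricAlgebra ℝ V)) with
      norm_smul_le := mulExt_smul_le }
  refine nonneg_of_forall_character_nonneg hn (abs_le_mulExt hC hL) hpos fun α hα => ?_
  -- A contractive character restricts to a point of the ball because `mulExt ρ ≤ ρ` on `V`.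
  have := hf (α.toLinearMap ∘ₗ SymmetricAlgebra.ι ℝ V) (mem_dualBall_iff.2 fun w =>
    (hα _).trans (mulExt_le (.ι w)))
  have heq : SymmetricAlgebra.lift (α.toLinearMap ∘ₗ SymmetricAlgebra.ι ℝ V) = α :=
    SymmetricAlgebra.algHom_ext (SymmetricAlgebra.lift_comp_ι _)
  rw [← heq]
  exact this

theorem abs_hat_le_projExt {v : AlgDual V} (hv : v ∈ dualBall ρ) (f : SymmetricAlgebra ℝ V) :
    |hat f v| ≤ projExt ρ f := by
  classical
  have hhom (k : ℕ) (g : homPart V k) : |hat (g : SymmetricAlgebra ℝ V) v| ≤ projHom ρ k g := by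
    obtain ⟨g, hg⟩ := g
    cases k with
    | zero =>
      rw [homPart, pow_zero] at hg
      obtain ⟨t, rfl⟩ := Submodule.mem_one.1 hg
      simp [hat, projHom]
    | succ k =>
      obtain ⟨n₀, g₀, hn₀, h₀⟩ := exists_eq_sum_prod_ι hg
      refine le_csInf ⟨_, n₀, g₀, hn₀, h₀, rfl⟩ ?_
      rintro _ ⟨n, h, -, rfl, rfl⟩
      simp only [hat, map_sum, map_prod, SymmetricAlgebra.lift_ι_apply]
      refine (Finset.abs_sum_le_sum_abs _ _).trans (Finset.sum_le_sum fun i _ => ?_)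
      rw [Finset.abs_prod]
      exact Finset.prod_le_prod (fun j _ => abs_nonneg _) fun j _ => mem_dualBall_iff.1 hv _
  conv_lhs => rw [← DirectSum.sum_support_decompose (homPart V) f]
  rw [hat, map_sum, projExt]
  refine (Finset.abs_sum_le_sum_abs _ _).trans ?_
  exact Finset.sum_le_sum fun k _ => hhom k (DirectSum.decompose (homPart V) f k)

end ProjectiveSeminorm

/-! ### Compact spaces: density, signs and representing measures. -/

section CompactSpace

open CompactlySupported

variable {X : Type*} [TopologicalSpace X] [CompactSpace X]

theorem continuous_integral_continuousMap [MeasurableSpace X] [BorelSpace X] (ν : Measure X)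
    [IsFiniteMeasure ν] :
    Continuous fun h : C(X, ℝ) => ∫ x, h x ∂ν := by
  refine LipschitzWith.continuous (K := ⟨ν.real Set.univ, measureReal_nonneg⟩)
    (LipschitzWith.of_dist_le_mul fun h h' => ?_)
  rw [dist_eq_norm, ← integral_sub (h.continuous.integrable_of_hasCompactSupport
    (HasCompactSupport.of_compactSpace _)) (h'.continuous.integrable_of_hasCompactSupport
    (HasCompactSupport.of_compactSpace _)), dist_eq_norm, mul_comm]
  exact norm_integral_le_of_norm_le_const (.of_forall fun x => (h - h').norm_coe_le_norm x)

variable {A : Type*} [CommRing A] [Algebra ℝ A] {Φ : A →ₐ[ℝ] C(X, ℝ)}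

theorem denseRange_of_separatesPoints (hΦ : ∀ x y, x ≠ y → ∃ a, Φ a x ≠ Φ a y) :
    DenseRange Φ := by
  have hsep : Φ.range.SeparatesPoints := by
    intro x y hxy
    obtain ⟨a, ha⟩ := hΦ x y hxy
    exact ⟨Φ a, ⟨Φ a, ⟨a, rfl⟩, rfl⟩, ha⟩
  intro h
  have := ContinuousMap.continuousMap_mem_subalgebra_closure_of_separatesPoints _ hsep h
  rwa [← SetLike.mem_coe, Subalgebra.topologicalClosure_coe, AlgHom.coe_range] at this

/-- If the integrals of `h ^ n * g` are nonnegative for `h` in a dense set of continuous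
functions, then `g` is nonnegative almost everywhere. -/
theorem measure_setOf_neg_eq_zero [MeasurableSpace X] [BorelSpace X] (ν : Measure X)
    [IsFiniteMeasure ν] {n : ℕ} (hn : n ≠ 0)
    (hdense : DenseRange Φ) {g : C(X, ℝ)} (hg : ∀ a, 0 ≤ ∫ x, (Φ a ^ n * g) x ∂ν) :
    ν {x | g x < 0} = 0 := by
  have hall (h : C(X, ℝ)) : 0 ≤ ∫ x, (h ^ n * g) x ∂ν := by
    refine hdense.induction_on h ?_ hg
    exact isClosed_le continuous_const
      ((continuous_integral_continuousMap ν).comp (by fun_prop))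
  -- The `n`-th root of the negative part of `g`, so that `h ^ n * g` is minus the square of that
  -- part.
  let h : C(X, ℝ) := ⟨fun x => (max (-g x) 0) ^ (n : ℝ)⁻¹, by
    refine Continuous.rpow_const (by fun_prop) fun x => Or.inr (by positivity)⟩
  have hpow (x : X) : (h ^ n * g) x = -(max (-g x) 0) ^ 2 := by
    have : (h ^ n) x = max (-g x) 0 := by
      change ((max (-g x) 0) ^ (n : ℝ)⁻¹) ^ n = _
      exact Real.rpow_inv_natCast_pow (le_max_right _ _) hn
    rw [ContinuousMap.mul_apply, this]
    rcases le_total (-g x) 0 with h0 | h0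
    · simp [max_eq_right h0]
    · rw [max_eq_left h0]; ring
  have hint : ∫ x, (max (-g x) 0) ^ 2 ∂ν = 0 := by
    have := hall h
    simp only [hpow, integral_neg] at this
    exact le_antisymm (by linarith) (integral_nonneg fun x => sq_nonneg _)
  rw [integral_eq_zero_iff_of_nonneg (fun x => sq_nonneg _)
    (Continuous.integrable_of_hasCompactSupport (Continuous.pow (by fun_prop) 2)
      (HasCompactSupport.of_compactSpace _))] at hint
  refine measure_mono_null (fun x hx => ?_) (ae_iff.1 hint)
  have hx : g x < 0 := hx
  have : 0 < max (-g x) 0 := lt_max_of_lt_left (by linarith)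
  exact (pow_pos this 2).ne'

theorem eq_of_integral_eq [MeasurableSpace X] [BorelSpace X] [T2Space X]
    {ν₁ ν₂ : Measure X} [ν₁.Regular] [ν₂.Regular]
    (hdense : DenseRange Φ) (h : ∀ a, ∫ x, Φ a x ∂ν₁ = ∫ x, Φ a x ∂ν₂) : ν₁ = ν₂ := by
  refine Measure.ext_of_integral_eq_on_compactlySupported fun f => ?_
  exact hdense.induction_on (p := fun f : C(X, ℝ) => ∫ x, f x ∂ν₁ = ∫ x, f x ∂ν₂)
    f.toContinuousMap (isClosed_eq (continuous_integral_continuousMap ν₁)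
      (continuous_integral_continuousMap ν₂)) h

/-- A linear functional on an algebra of continuous functions on a compact space that is positive
on nonnegative functions extends to all continuous functions. -/
theorem exists_positive_extension {L : A →ₗ[ℝ] ℝ} (hL : ∀ a, (∀ x, 0 ≤ Φ a x) → 0 ≤ L a) :
    ∃ Λ : C(X, ℝ) →ₗ[ℝ] ℝ, (∀ h, 0 ≤ h → 0 ≤ Λ h) ∧ ∀ a, Λ (Φ a) = L a := by
  -- Working in the product avoids factoring `L` through the image of `Φ`, which need not be
  -- injective.
  let cone : PointedCone ℝ (A × C(X, ℝ)) :=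
    { carrier := {p | ∀ x, 0 ≤ Φ p.1 x + p.2 x}
      add_mem' := fun {p q} hp hq x => by
        have := hp x
        have := hq x
        simp only [Prod.fst_add, Prod.snd_add, map_add, ContinuousMap.add_apply]
        linarith
      zero_mem' := fun x => by simp
      smul_mem' := fun t p hp x => by
        have := mul_nonneg t.2 (hp x)
        change 0 ≤ Φ ((t : ℝ) • p.1) x + ((t : ℝ) • p.2) x
        rw [map_smul, ContinuousMap.smul_apply, ContinuousMap.smul_apply, smul_eq_mul,
          smul_eq_mul, ← mul_add]
        exact this }
  let f : (A × C(X, ℝ)) →ₗ.[ℝ] ℝ :=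
    ⟨LinearMap.ker (LinearMap.snd ℝ A C(X, ℝ)),
      L ∘ₗ LinearMap.fst ℝ A C(X, ℝ) ∘ₗ Submodule.subtype _⟩
  obtain ⟨G, hG, hGpos⟩ := riesz_extension cone f
    (by
      rintro ⟨⟨a, h⟩, hh⟩ hmem
      obtain rfl : h = 0 := hh
      refine hL a fun x => ?_
      simpa using hmem x)
    (by
      rintro ⟨a, h⟩
      refine ⟨⟨(-a + algebraMap ℝ A ‖h‖, 0), rfl⟩, fun x => ?_⟩
      have := neg_le_of_abs_le (h.norm_coe_le_norm x)
      simp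
      linarith)
  refine ⟨G ∘ₗ LinearMap.inr ℝ A C(X, ℝ), fun h hh => hGpos _ fun x => ?_, fun a => ?_⟩
  · simpa using hh x
  · have h1 : G (a, 0) = L a := hG ⟨(a, 0), rfl⟩
    -- Both `(a, -Φ a)` and its negative lie in the cone, so `G` vanishes there.
    have h2 : 0 ≤ G (a, -Φ a) := hGpos _ fun x => by simp
    have h3 : 0 ≤ G (-a, Φ a) := hGpos _ fun x => by simp
    have e2 : G (a, -Φ a) = G (a, 0) - G (0, Φ a) := by rw [← map_sub]; simp
    have e3 : G (-a, Φ a) = G (0, Φ a) - G (a, 0) := by rw [← map_sub]; simp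
    change G (0, Φ a) = L a
    linarith

theorem exists_measure_of_nonneg [MeasurableSpace X] [BorelSpace X] [T2Space X] {L : A →ₗ[ℝ] ℝ}
    (hL : ∀ a, (∀ x, 0 ≤ Φ a x) → 0 ≤ L a) :
    ∃ ν : Measure X, ν.Regular ∧ IsFiniteMeasure ν ∧ ∀ a, L a = ∫ x, Φ a x ∂ν := by
  obtain ⟨Λ, hΛ, hΛΦ⟩ := exists_positive_extension hL
  let Λ' : C_c(X, ℝ) →ₚ[ℝ] ℝ := PositiveLinearMap.mk₀
    { toFun := fun f => Λ f.toContinuousMap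
      map_add' := fun f g => Λ.map_add f.toContinuousMap g.toContinuousMap
      map_smul' := fun t f => Λ.map_smul t f.toContinuousMap }
    fun f hf => hΛ f.toContinuousMap hf
  refine ⟨RealRMK.rieszMeasure Λ', inferInstance, inferInstance, fun a => ?_⟩
  rw [← hΛΦ a]
  exact (RealRMK.integral_rieszMeasure Λ'
    (CompactlySupportedContinuousMap.continuousMapEquiv (Φ a))).symm

end CompactSpace

/-! ### The weak topology on the algebraic dual and its compact ball. -/

section AlgebraicDual

open Topology

variable {V : Type*} [AddCommGroup V] [Module ℝ V] {ρ : Seminorm ℝ V}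

theorem AlgDual.isEmbedding_coe : IsEmbedding fun (v : AlgDual V) (w : V) => v.toLin w :=
  WeakBilin.isEmbedding (B := (LinearMap.id : (V →ₗ[ℝ] ℝ) →ₗ[ℝ] V →ₗ[ℝ] ℝ))
    Function.injective_id

instance : T2Space (AlgDual V) := AlgDual.isEmbedding_coe.t2Space

theorem AlgDual.continuous_eval (w : V) : Continuous fun v : AlgDual V => v.toLin w :=
  (continuous_apply w).comp AlgDual.isEmbedding_coe.continuous

theorem hat_algebraMap (t : ℝ) (v : AlgDual V) : hat (algebraMap ℝ _ t) v = t := by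
  simp [hat]

theorem hat_ι (w : V) (v : AlgDual V) : hat (SymmetricAlgebra.ι ℝ V w) v = v.toLin w := by
  simp [hat]

theorem hat_add (f g : SymmetricAlgebra ℝ V) (v : AlgDual V) :
    hat (f + g) v = hat f v + hat g v :=
  map_add (SymmetricAlgebra.lift v.toLin) f g

theorem hat_mul (f g : SymmetricAlgebra ℝ V) (v : AlgDual V) :
    hat (f * g) v = hat f v * hat g v :=
  map_mul (SymmetricAlgebra.lift v.toLin) f g

theorem hat_smul (t : ℝ) (f : SymmetricAlgebra ℝ V) (v : AlgDual V) :
    hat (t • f) v = t * hat f v :=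
  map_smul (SymmetricAlgebra.lift v.toLin) t f

theorem continuous_hat (f : SymmetricAlgebra ℝ V) : Continuous (hat f) := by
  induction f using SymmetricAlgebra.induction with
  | algebraMap t => simpa only [funext (hat_algebraMap t)] using continuous_const
  | ι w => simpa only [funext (hat_ι w)] using AlgDual.continuous_eval w
  | mul f g hf hg => exact (hf.mul hg).congr fun v => (hat_mul f g v).symm
  | add f g hf hg => exact (hf.add hg).congr fun v => (hat_add f g v).symm

/-- Banach–Alaoglu: inside the product of the intervals `[-ρ w, ρ w]`, linearity is a closed
condition. -/
theorem isCompact_dualBall (ρ : Seminorm ℝ V) : IsCompact (dualBall ρ) := by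
  rw [AlgDual.isEmbedding_coe.isInducing.isCompact_iff]
  refine (isCompact_univ_pi fun w : V =>
    isCompact_Icc (a := -ρ w) (b := ρ w)).of_isClosed_subset ?_ ?_
  · have : (fun (v : AlgDual V) (w : V) => v.toLin w) '' dualBall ρ =
        {φ | ∀ x y, φ (x + y) = φ x + φ y} ∩ {φ | ∀ (t : ℝ) x, φ (t • x) = t • φ x} ∩
          {φ | ∀ w, |φ w| ≤ ρ w} := by
      ext φ
      constructor
      · rintro ⟨v, hv, rfl⟩
        exact ⟨⟨v.toLin.map_add, v.toLin.map_smul⟩, mem_dualBall_iff.1 hv⟩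
      · rintro ⟨⟨h1, h2⟩, h3⟩
        let v : AlgDual V := (⟨⟨φ, h1⟩, h2⟩ : V →ₗ[ℝ] ℝ)
        exact ⟨v, mem_dualBall_iff.2 h3, rfl⟩
    rw [this]
    refine (IsClosed.inter ?_ ?_).inter ?_
    · simp only [Set.ofPred_forall]
      exact isClosed_iInter fun x => isClosed_iInter fun y =>
        isClosed_eq (by fun_prop) (by fun_prop)
    · simp only [Set.ofPred_forall]
      exact isClosed_iInter fun x => isClosed_iInter fun y =>
        isClosed_eq (by fun_prop) (by fun_prop)
    · simp only [Set.ofPred_forall]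
      exact isClosed_iInter fun x => isClosed_le (by fun_prop) (by fun_prop)
  · rintro _ ⟨v, hv, rfl⟩ w -
    exact abs_le.1 (mem_dualBall_iff.1 hv w)

instance : CompactSpace (dualBall ρ) := isCompact_iff_compactSpace.1 (isCompact_dualBall ρ)

theorem measurableSet_dualBall (ρ : Seminorm ℝ V) : MeasurableSet (dualBall ρ) :=
  (isCompact_dualBall ρ).isClosed.measurableSet

/-- Restriction of the elements of `S(V)`, as functions, to the dual unit ball. -/
def hatBall (ρ : Seminorm ℝ V) : SymmetricAlgebra ℝ V →ₐ[ℝ] C(dualBall ρ, ℝ) where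
  toFun f := ⟨fun v => hat f v, (continuous_hat f).comp continuous_subtype_val⟩
  map_one' := by ext v; exact map_one (SymmetricAlgebra.lift v.1.toLin)
  map_mul' f g := by ext v; exact hat_mul f g v
  map_zero' := by ext v; exact map_zero (SymmetricAlgebra.lift v.1.toLin)
  map_add' f g := by ext v; exact hat_add f g v
  commutes' t := by ext v; exact hat_algebraMap t v.1

theorem hatBall_apply (f : SymmetricAlgebra ℝ V) (v : dualBall ρ) : hatBall ρ f v = hat f v := rfl

/-- Elements of `V` already separate points. -/
theorem denseRange_hatBall (ρ : Seminorm ℝ V) : DenseRange (hatBall ρ) := by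
  refine denseRange_of_separatesPoints fun v v' hne => ?_
  by_contra! h
  refine hne (Subtype.ext (LinearMap.ext fun w => ?_))
  have := h (SymmetricAlgebra.ι ℝ V w)
  rwa [hatBall_apply, hatBall_apply, hat_ι, hat_ι] at this

end AlgebraicDual

/-! ### Transfer between the ball and `V*`, and the correspondence. -/

section Measures

variable {V : Type*} [AddCommGroup V] [Module ℝ V] {ρ : Seminorm ℝ V}

theorem restrict_dualBall_eq {μ : Measure (AlgDual V)} (hs : IsSupportedBy μ (dualBall ρ)) :
    μ.restrict (dualBall ρ) = μ :=
  Measure.restrict_eq_self_of_ae_mem (ae_iff.2 hs)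

theorem IsRadon.isFiniteMeasure {μ : Measure (AlgDual V)} (hμ : IsRadon μ)
    (hs : IsSupportedBy μ (dualBall ρ)) : IsFiniteMeasure μ := by
  have := hμ.locallyFinite
  rw [← restrict_dualBall_eq hs]
  exact ⟨by simpa using (isCompact_dualBall ρ).measure_lt_top⟩

theorem map_comap_dualBall {μ : Measure (AlgDual V)} (hs : IsSupportedBy μ (dualBall ρ)) :
    (μ.comap ((↑) : dualBall ρ → AlgDual V)).map (↑) = μ := by
  rw [map_comap_subtype_coe (measurableSet_dualBall ρ), restrict_dualBall_eq hs]

theorem integral_comap_dualBall {μ : Measure (AlgDual V)} (hs : IsSupportedBy μ (dualBall ρ))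
    (F : AlgDual V → ℝ) :
    ∫ v, F v ∂(μ.comap ((↑) : dualBall ρ → AlgDual V)) = ∫ v, F v ∂μ := by
  rw [integral_subtype_comap (measurableSet_dualBall ρ), restrict_dualBall_eq hs]

theorem isFiniteMeasure_comap_dualBall {μ : Measure (AlgDual V)} (hμ : IsRadon μ)
    (hs : IsSupportedBy μ (dualBall ρ)) :
    IsFiniteMeasure (μ.comap ((↑) : dualBall ρ → AlgDual V)) := by
  have := hμ.isFiniteMeasure hs
  refine ⟨?_⟩
  rw [comap_subtype_coe_apply (measurableSet_dualBall ρ)]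
  exact measure_lt_top μ _

theorem regular_comap_dualBall {μ : Measure (AlgDual V)} (hμ : IsRadon μ)
    (hs : IsSupportedBy μ (dualBall ρ)) :
    (μ.comap ((↑) : dualBall ρ → AlgDual V)).Regular := by
  have := hμ.innerRegular
  have := isFiniteMeasure_comap_dualBall hμ hs
  have hemb := MeasurableEmbedding.subtype_coe (measurableSet_dualBall ρ)
  have : (μ.comap ((↑) : dualBall ρ → AlgDual V)).InnerRegular :=
    ⟨hμ.innerRegular.innerRegular.comap hemb (fun U hU => hemb.measurableSet_image.2 hU)
      fun K hK hKc => Topology.IsInducing.subtypeVal.isCompact_preimage' hKc hK⟩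
  infer_instance

theorem Represents.measure_unique {L : SymmetricAlgebra ℝ V →ₗ[ℝ] ℝ} {μ₁ μ₂ : Measure (AlgDual V)}
    (h₁ : IsRadon μ₁) (hs₁ : IsSupportedBy μ₁ (dualBall ρ)) (hL₁ : Represents L μ₁)
    (h₂ : IsRadon μ₂) (hs₂ : IsSupportedBy μ₂ (dualBall ρ)) (hL₂ : Represents L μ₂) :
    μ₁ = μ₂ := by
  have := regular_comap_dualBall h₁ hs₁
  have := regular_comap_dualBall h₂ hs₂
  rw [← map_comap_dualBall hs₁, ← map_comap_dualBall hs₂]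
  refine congrArg _ (eq_of_integral_eq (denseRange_hatBall ρ) fun f => ?_)
  simp only [hatBall_apply]
  rw [integral_comap_dualBall hs₁ (hat f), integral_comap_dualBall hs₂ (hat f), ← (hL₁ f).2,
    ← (hL₂ f).2]

theorem integrable_hat {μ : Measure (AlgDual V)} [IsFiniteMeasure μ]
    (hs : IsSupportedBy μ (dualBall ρ)) (f : SymmetricAlgebra ℝ V) : Integrable (hat f) μ := by
  refine Integrable.of_bound (continuous_hat f).measurable.aestronglyMeasurable (projExt ρ f) ?_
  exact measure_mono_null (fun v hv hmem => hv (abs_hat_le_projExt hmem f)) hs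

theorem exists_measure_represents {n : ℕ} (hn : n ≠ 0) {L : SymmetricAlgebra ℝ V →ₗ[ℝ] ℝ}
    (hL : IsProjContinuous ρ L) (hpos : ∀ a, 0 ≤ L (a ^ n)) :
    ∃ μ : Measure (AlgDual V), (IsRadon μ ∧ IsSupportedBy μ (dualBall ρ)) ∧ Represents L μ := by
  obtain ⟨ν, hν, hfin, hLν⟩ := exists_measure_of_nonneg (Φ := hatBall ρ) (L := L) fun f hf =>
    nonneg_of_forall_mem_dualBall hn hL hpos fun v hv => hf ⟨v, hv⟩
  have hs : IsSupportedBy (ν.map ((↑) : dualBall ρ → AlgDual V)) (dualBall ρ) := by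
    rw [IsSupportedBy, Measure.map_apply (by fun_prop) (measurableSet_dualBall ρ).compl]
    simp
  refine ⟨ν.map (↑), ⟨⟨inferInstance,
    Measure.InnerRegular.map_of_continuous continuous_subtype_val⟩, hs⟩,
    fun f => ⟨integrable_hat hs f, ?_⟩⟩
  rw [hLν f, integral_map (by fun_prop) (continuous_hat f).measurable.aestronglyMeasurable]
  rfl

theorem hat_sumPow_nonneg {d : ℕ} {f : SymmetricAlgebra ℝ V}
    (hf : f ∈ sumPow (SymmetricAlgebra ℝ V) (2 * d)) (v : AlgDual V) : 0 ≤ hat f v := by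
  obtain ⟨m, b, rfl⟩ := hf
  rw [hat, map_sum]
  refine Finset.sum_nonneg fun i _ => ?_
  rw [map_pow, pow_mul]
  exact pow_nonneg (sq_nonneg _) d

theorem exists_functional_represents (d : ℕ) {μ : Measure (AlgDual V)} (hμ : IsRadon μ)
    (hs : IsSupportedBy μ (dualBall ρ)) :
    ∃ L : SymmetricAlgebra ℝ V →ₗ[ℝ] ℝ,
      (IsProjContinuous ρ L ∧ IsPositiveOn (sumPow (SymmetricAlgebra ℝ V) (2 * d)) L) ∧
        Represents L μ := by
  have := hμ.isFiniteMeasure hs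
  have hint := integrable_hat hs
  refine ⟨{ toFun := fun f => ∫ v, hat f v ∂μ
            map_add' := fun f g => ?_
            -- The total mass suffices as a bound; `+ 1` makes the constant positive when `μ = 0`.
            map_smul' := fun t f => ?_ }, ⟨⟨μ.real Set.univ + 1, by positivity, fun f => ?_⟩,
    fun f hf => integral_nonneg (hat_sumPow_nonneg hf)⟩, fun f => ⟨hint f, rfl⟩⟩
  · simp only [hat_add]
    exact integral_add (hint f) (hint g)
  · simp only [hat_smul]
    exact integral_const_mul t _
  · have hbound : ∀ᵐ v ∂μ, ‖hat f v‖ ≤ projExt ρ f :=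
      measure_mono_null (fun v hv hmem => hv (abs_hat_le_projExt hmem f)) hs
    have h0 : 0 ≤ projExt ρ f := Finset.sum_nonneg fun k _ => projHom_nonneg k _
    have := norm_integral_le_of_norm_le_const hbound
    rw [Real.norm_eq_abs] at this
    simp only [LinearMap.coe_mk, AddHom.coe_mk]
    nlinarith

/-- A functional represented by a Radon measure on the dual unit ball is nonnegative on a power
module iff the measure is supported by its nonnegativity set. -/
theorem Represents.isPositiveOn_iff {d : ℕ} (hd : 1 ≤ d) {M : Set (SymmetricAlgebra ℝ V)}
    (hM : IsPowerModule d M) {L : SymmetricAlgebra ℝ V →ₗ[ℝ] ℝ} {μ : Measure (AlgDual V)}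
    (hμ : IsRadon μ) (hs : IsSupportedBy μ (dualBall ρ)) (hL : Represents L μ) :
    IsPositiveOn M L ↔ IsSupportedBy μ (nonnegSet M ∩ dualBall ρ) := by
  constructor
  · intro hpos
    have hfin := isFiniteMeasure_comap_dualBall hμ hs
    have hneg (g) (hg : g ∈ M) : μ {v | hat g v < 0} = 0 := by
      have h0 := measure_setOf_neg_eq_zero (μ.comap ((↑) : dualBall ρ → AlgDual V))
        (n := 2 * d) (by omega) (denseRange_hatBall ρ) (g := hatBall ρ g) fun a => by
          rw [← map_pow, ← map_mul]
          simp only [hatBall_apply]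
          rw [integral_comap_dualBall hs (hat _), ← (hL _).2]
          exact hpos _ (hM.pow_mul_mem a g hg)
      rw [← map_comap_dualBall hs, Measure.map_apply (by fun_prop)
        (isOpen_lt (continuous_hat g) continuous_const).measurableSet]
      exact h0
    -- `M` may be uncountable, so countable additivity is not enough. The complement is a union of
    -- null open sets, hence each compact subset of it is null, and inner regularity concludes.
    have hX : μ (nonnegSet M)ᶜ = 0 := by
      have hcompl : (nonnegSet M)ᶜ = ⋃ g ∈ M, {v | hat g v < 0} := by
        ext v
        simp [nonnegSet]
      have hopen (g : SymmetricAlgebra ℝ V) : IsOpen {v | hat g v < 0} :=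
        isOpen_lt (continuous_hat g) continuous_const
      have := hμ.innerRegular
      rw [hcompl, (isOpen_biUnion fun g _ => hopen g).measurableSet.measure_eq_iSup_isCompact]
      simp only [ENNReal.iSup_eq_zero]
      intro K hK hKc
      refine hKc.measure_zero_of_nhdsWithin fun v hv => ?_
      obtain ⟨g, hg, hgv⟩ := Set.mem_iUnion₂.1 (hK hv)
      exact ⟨_, mem_nhdsWithin_of_mem_nhds ((hopen g).mem_nhds hgv), hneg g hg⟩
    rw [IsSupportedBy, Set.compl_inter]
    exact measure_union_null hX hs
  · intro hsup g hg
    rw [(hL g).2]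
    refine integral_nonneg_of_ae ?_
    have hsub : {v | ¬ 0 ≤ hat g v} ⊆ (nonnegSet M ∩ dualBall ρ)ᶜ :=
      fun v hv hmem => hv (hmem.1 g hg)
    exact measure_mono_null hsub hsup

/-- The correspondence between functionals and representing measures. -/
theorem exists_equiv_represents (ρ : Seminorm ℝ V) (d : ℕ) (hd : 1 ≤ d) :
    ∃ e : PosFunctional ρ d ≃ BallMeasure ρ,
      ∀ (L : PosFunctional ρ d) (μ : BallMeasure ρ), e L = μ ↔ Represents L.1 μ.1 := by
  have hex (L : PosFunctional ρ d) : ∃ μ : BallMeasure ρ, Represents L.1 μ.1 := by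
    obtain ⟨μ, hμ, hrep⟩ := exists_measure_represents (n := 2 * d) (by omega) L.2.1
      fun a => L.2.2 _ ⟨1, fun _ => a, by simp⟩
    exact ⟨⟨μ, hμ⟩, hrep⟩
  choose m hm using hex
  have huniq (L : PosFunctional ρ d) (μ : BallMeasure ρ) : m L = μ ↔ Represents L.1 μ.1 := by
    refine ⟨fun h => h ▸ hm L, fun h => Subtype.ext ?_⟩
    exact (hm L).measure_unique (m L).2.1 (m L).2.2 μ.2.1 μ.2.2 h
  refine ⟨Equiv.ofBijective m ⟨fun L L' h => ?_, fun μ => ?_⟩, huniq⟩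
  · refine Subtype.ext (LinearMap.ext fun f => ?_)
    rw [(hm L f).2, (hm L' f).2, h]
  · obtain ⟨L, hL, hrep⟩ := exists_functional_represents d μ.2.1 μ.2.2
    exact ⟨⟨L, hL⟩, (huniq _ _).2 hrep⟩

end Measures

end SymMoment

theorem corollary3p8 {V : Type*} [AddCommGroup V] [Module ℝ V] (ρ : Seminorm ℝ V)
    (d : ℕ) (hd : 1 ≤ d) :
    ∃ e : SymMoment.PosFunctional ρ d ≃ SymMoment.BallMeasure ρ,
      (∀ (L : SymMoment.PosFunctional ρ d) (μ : SymMoment.BallMeasure ρ),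
        e L = μ ↔ SymMoment.Represents L.1 μ.1) ∧
      ∀ M : Set (SymmetricAlgebra ℝ V), SymMoment.IsPowerModule d M →
        ∀ L : SymMoment.PosFunctional ρ d,
          SymMoment.IsPositiveOn M L.1 ↔
            SymMoment.IsSupportedBy (e L).1
              (SymMoment.nonnegSet M ∩ SymMoment.dualBall ρ) := by
  obtain ⟨e, he⟩ := SymMoment.exists_equiv_represents ρ d hd
  exact ⟨e, he, fun M hM L => ((he L (e L)).1 rfl).isPositiveOn_iff hd hM (e L).2.1 (e L).2.2⟩
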